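/- Let $\rho=e^{2\pi i/3}$, let $E=\mathbb C/\mathbb Z[\rho]$ and $A=E\times E$, and let $v_1=(1,0)$, $v_2=(\rho,0)$, $v_3=(0,1)$, $v_4=(0,\rho)$ be the standard generators of $\pi_1(A)=\mathbb Z[\rho]\times\mathbb Z[\rho]\subset\mathbb C^2$. Fix an integer $n\ge 0$ and a generator $\delta$ of the additive group $\mathbb Z/3^n$. For an integer $0\le j<3^n$ let $\sigma_{n,j}:\pi_1(A)\to\mathbb Z/3^n$ be the homomorphism with $\sigma_{n,j}(v_1)=\sigma_{n,j}(v_2)=\delta$ and $\sigma_{n,j}(v_3)=\sigma_{n,j}(v_4)=j\delta$, let $K_{n,j}\subset\mathbb C^2$ be its kernel, let $A_{n,j}=\mathbb C^2/K_{n,j}$ be the corresponding covering torus with covering map $s_{n,j}:A_{n,j}\to A$ induced by the identity of $\mathbb C^2$, and let $A^*_{n,j}$ be the blowup of the complex surface $A_{n,j}$ at the points of the finite set $s_{n,j}^{-1}([0,0])$. Then for all integers $0\le j,k<3^n$ the complex surfaces $A^*_{n,j}$ and $A^*_{n,k}$ are biholomorphic. The sets $s_{n,j}^{-1}([0,0])$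 and $s_{n,k}^{-1}([0,0])$ each have exactly $3^n$ elements. Moreover, for every integer $r\equiv j-k \pmod{3^n}$, the linear map $f$ of $\mathbb C^2$ with matrix $\begin{pmatrix}1&r\\0&1\end{pmatrix}$ satisfies $f(K_{n,j})=K_{n,k}$; it induces a biholomorphic map $\varphi:A_{n,j}\to A_{n,k}$, $[z]\mapsto[f(z)]$, with $\varphi\big(s_{n,j}^{-1}([0,0])\big)=s_{n,k}^{-1}([0,0])$; and there is a biholomorphic map $A^*_{n,j}\to A^*_{n,k}$ lying over $\varphi$ with respect to the two blowdown maps. -/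

import Mathlib

open scoped Manifold ContDiff LinearAlgebra.Projectivization

/-! ### Complex tori of dimension two as complex manifolds -/

namespace ComplexTorus

variable (L : AddSubgroup (ℂ × ℂ)) [DiscreteTopology L]

/-- For a discrete subgroup `L` of `ℂ²`, the projection `ℂ² → ℂ² / L` is a local homeomorphism. -/
theorem isLocalHomeomorph_mk :
    IsLocalHomeomorph (QuotientAddGroup.mk : ℂ × ℂ → (ℂ × ℂ) ⧸ L) :=
  (AddSubgroup.isAddQuotientCoveringMap_of_comm L
    (isDiscrete_iff_discreteTopology.mpr inferInstance)).isCoveringMap.isLocalHomeomorph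

/-- The complex structure on `ℂ² / L`: charts are local sections of the projection from `ℂ²`. -/
noncomputable instance instChartedSpace : ChartedSpace (ℂ × ℂ) ((ℂ × ℂ) ⧸ L) :=
  (isLocalHomeomorph_mk L).chartedSpace QuotientAddGroup.mk_surjective

instance instT1Space : T1Space ((ℂ × ℂ) ⧸ L) := by
  have : IsClosed (L : Set (ℂ × ℂ)) := AddSubgroup.isClosed_of_discrete
  infer_instance

/-- `ℂ² / L` is a complex manifold. -/
instance instIsManifold : IsManifold 𝓘(ℂ, ℂ × ℂ) ω ((ℂ × ℂ) ⧸ L) := by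
  apply isManifold_of_contDiffOn
  rintro _ _ ⟨q, rfl⟩ ⟨q', rfl⟩
  set a := (isLocalHomeomorph_mk L).localInverseAt
    ((QuotientAddGroup.mk_surjective (s := L)).hasRightInverse.choose q) with ha
  set b := (isLocalHomeomorph_mk L).localInverseAt
    ((QuotientAddGroup.mk_surjective (s := L)).hasRightInverse.choose q') with hb
  have hasymm : (a.symm : ℂ × ℂ → (ℂ × ℂ) ⧸ L) = QuotientAddGroup.mk := by
    simp [ha]
  have hbsec : ∀ y ∈ b.source, (QuotientAddGroup.mk (b y) : (ℂ × ℂ) ⧸ L) = y := by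
    intro y hy
    exact (isLocalHomeomorph_mk L).apply_localInverseAt_of_mem hy
  suffices h : ContDiffOn ℂ ω (b ∘ a.symm) (a.symm.trans b).source by
    simpa [ModelWithCorners.source_eq, chartAt_self_eq] using h
  intro z hz
  have hO : IsOpen (a.symm.trans b).source := (a.symm.trans b).open_source
  have hcont : ContinuousAt (b ∘ a.symm) z :=
    (a.symm.trans b).continuousOn.continuousAt (hO.mem_nhds hz)
  have hL : ∀ w ∈ (a.symm.trans b).source, (b ∘ a.symm) w - w ∈ L := by
    intro w hw
    have h1 : a.symm w ∈ b.source := by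
      simpa using (OpenPartialHomeomorph.trans_source a.symm b ▸ hw).2
    have h2 := hbsec _ h1
    rw [hasymm, QuotientAddGroup.eq] at h2
    have := L.neg_mem h2
    simpa [hasymm, sub_eq_add_neg, add_comm] using this
  obtain ⟨U, hU, hUL⟩ : ∃ U ∈ nhds (0 : ℂ × ℂ), ∀ x ∈ U, x ∈ L → x = 0 := by
    have h0 : ({0} : Set L) ∈ nhds (0 : L) := (isOpen_discrete _).mem_nhds rfl
    obtain ⟨U, hU, hU'⟩ := mem_nhds_subtype _ _ _ |>.mp h0
    exact ⟨U, hU, fun x hx hxL => congrArg Subtype.val (hU' (a := ⟨x, hxL⟩) hx)⟩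
  have hev : ∀ᶠ w in nhds z,
      ((b ∘ a.symm) w - w) - ((b ∘ a.symm) z - z) ∈ U := by
    have hc : ContinuousAt
        (fun w => ((b ∘ a.symm) w - w) - ((b ∘ a.symm) z - z)) z :=
      (hcont.sub continuousAt_id).sub continuousAt_const
    apply hc.preimage_mem_nhds
    simpa using hU
  have heq : (b ∘ a.symm) =ᶠ[nhds z] fun w => w + ((b ∘ a.symm) z - z) := by
    filter_upwards [hev, hO.mem_nhds hz] with w hw hwS
    have := hUL _ hw (L.sub_mem (hL w hwS) (hL z hz))
    rw [sub_eq_zero, sub_eq_iff_eq_add] at this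
    rw [this, add_comm]
  exact ((contDiffAt_id.add contDiffAt_const).congr_of_eventuallyEq heq).contDiffWithinAt

end ComplexTorus

/-! ### Blowing up a complex surface at finitely many points -/

/-- The set underlying the blowup of a complex surface `X` at the points of `S`: a point of the
blowup is a point `pt` of `X` together with, if `pt` belongs to `S`, a complex line in the tangent
space of `X` at `pt`. Here the tangent space at `p` is identified with `ℂ²` by means of the
preferred chart `chartAt (ℂ × ℂ) p`, as in Mathlib's `TangentSpace`. -/
structure BlowUp (X : Type*) (S : Set X) where
  /-- the image of the point under the blowdown map -/
  pt : X
  /-- the direction, over a point that is blown up -/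
  dir : pt ∈ S → ℙ ℂ (ℂ × ℂ)

namespace BlowUp

theorem ext_of {X : Type*} {S : Set X} {y y' : BlowUp X S} (h : y.pt = y'.pt)
    (hd : ∀ h h', y.dir h = y'.dir h') : y = y' := by
  obtain ⟨p, d⟩ := y
  obtain ⟨p', d'⟩ := y'
  obtain rfl : p = p' := h
  congr
  funext h
  exact hd h h

/-- The identity of `ℂ²` (for `false`) or the exchange of the two coordinates (for `true`);
used to treat the two standard affine charts of the blowup of `ℂ²` at once. -/
def flip : Bool → ℂ × ℂ → ℂ × ℂ
  | false, z => z
  | true, z => (z.2, z.1)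

theorem flip_flip (i : Bool) (z : ℂ × ℂ) : flip i (flip i z) = z := by
  cases i <;> rfl

theorem flip_smul (i : Bool) (a : ℂ) (z : ℂ × ℂ) : flip i (a • z) = a • flip i z := by
  cases i <;> rfl

theorem flip_eq_zero (i : Bool) (z : ℂ × ℂ) : flip i z = 0 ↔ z = 0 := by
  cases i
  · rfl
  · simp [flip, Prod.ext_iff, and_comm]

theorem contDiff_flip (i : Bool) {n : WithTop ℕ∞} : ContDiff ℂ n (flip i) := by
  cases i
  · exact contDiff_id
  · exact contDiff_snd.prodMk contDiff_fst

theorem flip_one_ne_zero (i : Bool) (v : ℂ) : flip i (1, v) ≠ 0 := by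
  rw [Ne, flip_eq_zero]
  simp [Prod.ext_iff]

variable {X : Type*} [TopologicalSpace X] [ChartedSpace (ℂ × ℂ) X] {S : Set X}

open Classical in
/-- A vector spanning the line through the origin that is attached to the point `y` of the blowup
by the coordinates `chartAt p - chartAt p p` centred at `p`: the chosen direction if `y` lies over
`S` (used only for `y` over `p`), and the coordinate vector of `y` otherwise. -/
noncomputable def lineRep (p : X) (y : BlowUp X S) : ℂ × ℂ :=
  if h : y.pt ∈ S then (y.dir h).rep
  else chartAt (ℂ × ℂ) p y.pt - chartAt (ℂ × ℂ) p p

/-- The chart of the blowup away from the exceptional curves given by the preferred chart of `X`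
at `p`. -/
noncomputable def regularChart (S : Set X) (p : X) : PartialEquiv (BlowUp X S) (ℂ × ℂ) where
  toFun y := chartAt (ℂ × ℂ) p y.pt
  invFun w := ⟨(chartAt (ℂ × ℂ) p).symm w,
    fun _ => Projectivization.mk ℂ (1, 0) (by simp [Prod.ext_iff])⟩
  source := {y | y.pt ∈ (chartAt (ℂ × ℂ) p).source ∧ y.pt ∉ S}
  target := {w | w ∈ (chartAt (ℂ × ℂ) p).target ∧ (chartAt (ℂ × ℂ) p).symm w ∉ S}
  map_source' y hy := by
    refine ⟨(chartAt (ℂ × ℂ) p).map_source hy.1, ?_⟩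
    rw [(chartAt (ℂ × ℂ) p).left_inv hy.1]
    exact hy.2
  map_target' w hw := ⟨(chartAt (ℂ × ℂ) p).map_target hw.1, hw.2⟩
  left_inv' y hy := ext_of ((chartAt (ℂ × ℂ) p).left_inv hy.1) fun _ h => absurd h hy.2
  right_inv' w hw := (chartAt (ℂ × ℂ) p).right_inv hw.1

/-- The map `(u, v) ↦ (u, u v)` (or `(u, v) ↦ (u v, u)`) written in the coordinates at `p`: the
blowdown map in an affine chart. -/
noncomputable def affineDown (p : X) (i : Bool) (w : ℂ × ℂ) : ℂ × ℂ :=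
  chartAt (ℂ × ℂ) p p + flip i (w.1, w.1 * w.2)

/-- The inverse of an affine chart at the blown up point `p`: the pair `(u, v)` goes to the point
with coordinates `(u, u v)` (or `(u v, u)`) centred at `p`, with direction `[1 : v]`
(or `[v : 1]`). -/
noncomputable def affineInv (S : Set X) (p : X) (i : Bool) (w : ℂ × ℂ) : BlowUp X S :=
  ⟨(chartAt (ℂ × ℂ) p).symm (affineDown p i w),
    fun _ => Projectivization.mk ℂ (flip i (1, w.2)) (flip_one_ne_zero i w.2)⟩

/-- The set of pairs `(u, v)` for which the point with coordinates `(u, u v)` (or `(u v, u)`)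
belongs to the coordinate domain at `p`, and is no blown up point but possibly `p`. -/
def affineTarget (S : Set X) (p : X) (i : Bool) : Set (ℂ × ℂ) :=
  {w | affineDown p i w ∈ (chartAt (ℂ × ℂ) p).target ∧
    (chartAt (ℂ × ℂ) p).symm (affineDown p i w) ∉ S \ {p}}

theorem exists_lineRep_affineInv (p : X) (i : Bool) {w : ℂ × ℂ}
    (hp : p ∈ S) (hw : w ∈ affineTarget S p i) :
    ∃ a : ℂ, a ≠ 0 ∧ lineRep p (affineInv S p i w) = a • flip i (1, w.2) := by
  by_cases h : (affineInv S p i w).pt ∈ S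
  · obtain ⟨a, ha⟩ := Projectivization.exists_smul_eq_mk_rep ℂ (flip i (1, w.2))
      (flip_one_ne_zero i w.2)
    refine ⟨a, a.ne_zero, ?_⟩
    rw [lineRep, dif_pos h]
    exact ha.symm
  · refine ⟨w.1, ?_, ?_⟩
    · intro h0
      apply h
      have : affineDown p i w = chartAt (ℂ × ℂ) p p := by
        rw [affineDown, h0, zero_mul]
        simpa using (flip_eq_zero i (0, 0)).2 rfl
      change (chartAt (ℂ × ℂ) p).symm (affineDown p i w) ∈ S
      rw [this, (chartAt (ℂ × ℂ) p).left_inv (mem_chart_source _ p)]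
      exact hp
    · rw [lineRep, dif_neg h]
      change chartAt (ℂ × ℂ) p ((chartAt (ℂ × ℂ) p).symm (affineDown p i w)) - _ = _
      rw [(chartAt (ℂ × ℂ) p).right_inv hw.1, affineDown, add_sub_cancel_left, ← flip_smul]
      simp

/-- The coordinates of a point of the blowup in the affine chart `i` at the blown up point `p`. -/
noncomputable def affineCoord (p : X) (i : Bool) (y : BlowUp X S) : ℂ × ℂ :=
  ((flip i (chartAt (ℂ × ℂ) p y.pt - chartAt (ℂ × ℂ) p p)).1,
    (flip i (lineRep p y)).2 / (flip i (lineRep p y)).1)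

/-- The domain of the affine chart `i` at the blown up point `p`. -/
def affineSource (S : Set X) (p : X) (i : Bool) : Set (BlowUp X S) :=
  {y | y.pt ∈ (chartAt (ℂ × ℂ) p).source ∧ y.pt ∉ S \ {p} ∧ (flip i (lineRep p y)).1 ≠ 0}

theorem affineDown_affineCoord (p : X) (i : Bool) {y : BlowUp X S} (hy : y ∈ affineSource S p i) :
    affineDown p i (affineCoord p i y) = chartAt (ℂ × ℂ) p y.pt := by
  obtain ⟨-, h2, h3⟩ := hy
  obtain ⟨c, hc⟩ : ∃ c : ℂ, chartAt (ℂ × ℂ) p y.pt - chartAt (ℂ × ℂ) p p = c • lineRep p y := by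
    by_cases h : y.pt ∈ S
    · have : y.pt = p := by
        by_contra hne
        exact h2 ⟨h, hne⟩
      exact ⟨0, by rw [this]; simp⟩
    · exact ⟨1, by rw [lineRep, dif_neg h, one_smul]⟩
  rw [affineDown, affineCoord, hc, flip_smul]
  have : ((c • flip i (lineRep p y)).1, (c • flip i (lineRep p y)).1 *
      ((flip i (lineRep p y)).2 / (flip i (lineRep p y)).1)) = c • flip i (lineRep p y) := by
    refine Prod.ext rfl ?_
    change c * _ * _ = c * _
    field_simp
  dsimp only
  rw [this, flip_smul, flip_flip, ← hc]
  abel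

/-- The two affine charts of the blowup at a blown up point `p`, with coordinates
`(u, v) = (z, w / z)` and `(u, v) = (w, z / w)`, where `(z, w)` are the coordinates of `X` centred
at `p`; on the exceptional curve `v` is the slope of the direction. -/
noncomputable def affineChart (p : S) (i : Bool) : PartialEquiv (BlowUp X S) (ℂ × ℂ) where
  toFun := affineCoord (p : X) i
  invFun := affineInv S p i
  source := affineSource S p i
  target := affineTarget S p i
  map_source' y hy := by
    have h := affineDown_affineCoord (p : X) i hy
    refine ⟨?_, ?_⟩
    · rw [h]
      exact (chartAt (ℂ × ℂ) (p : X)).map_source hy.1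
    · rw [h, (chartAt (ℂ × ℂ) (p : X)).left_inv hy.1]
      exact hy.2.1
  map_target' w hw := by
    obtain ⟨a, ha, h⟩ := exists_lineRep_affineInv (p : X) i p.2 hw
    refine ⟨(chartAt (ℂ × ℂ) (p : X)).map_target hw.1, hw.2, ?_⟩
    rw [h, flip_smul, flip_flip]
    simpa using ha
  left_inv' y hy := by
    have h := affineDown_affineCoord (p : X) i hy
    refine ext_of ?_ ?_
    · change (chartAt (ℂ × ℂ) (p : X)).symm _ = _
      rw [h, (chartAt (ℂ × ℂ) (p : X)).left_inv hy.1]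
    · intro _ h'
      change Projectivization.mk ℂ _ _ = _
      rw [← Projectivization.mk_rep (y.dir h'), Projectivization.mk_eq_mk_iff']
      have hl : lineRep (p : X) y = (y.dir h').rep := by rw [lineRep, dif_pos h']
      have h3 := hy.2.2
      refine ⟨(flip i (lineRep (p : X) y)).1⁻¹, ?_⟩
      rw [← hl]
      conv_lhs => rw [← flip_flip i (lineRep (p : X) y), ← flip_smul]
      congr 1
      rw [flip_flip]
      refine Prod.ext ?_ ?_
      · exact inv_mul_cancel₀ h3
      · exact (div_eq_inv_mul _ _).symm
  right_inv' w hw := by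
    obtain ⟨a, ha, h⟩ := exists_lineRep_affineInv (p : X) i p.2 hw
    refine Prod.ext ?_ ?_
    · change (flip i (chartAt (ℂ × ℂ) (p : X)
        ((chartAt (ℂ × ℂ) (p : X)).symm (affineDown (p : X) i w)) - _)).1 = _
      rw [(chartAt (ℂ × ℂ) (p : X)).right_inv hw.1, affineDown, add_sub_cancel_left, flip_flip]
    · change _ / _ = _
      rw [h, flip_smul, flip_flip]
      simp [ha]

/-- The charts of the blowup: all regular charts and all affine charts. -/
def blowUpAtlas (X : Type*) [TopologicalSpace X] [ChartedSpace (ℂ × ℂ) X] (S : Set X) :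
    Set (PartialEquiv (BlowUp X S) (ℂ × ℂ)) :=
  Set.range (regularChart S) ∪ Set.range fun q : S × Bool => affineChart q.1 q.2

open Classical in
/-- A chart of the blowup around the point `y`. -/
noncomputable def blowUpChartAt (y : BlowUp X S) : PartialEquiv (BlowUp X S) (ℂ × ℂ) :=
  if h : y.pt ∈ S then affineChart ⟨y.pt, h⟩ (decide ((lineRep y.pt y).1 = 0))
  else regularChart S y.pt

theorem contDiff_affineDown (p : X) (i : Bool) {n : WithTop ℕ∞} :
    ContDiff ℂ n (affineDown p i) :=
  contDiff_const.add ((contDiff_flip i).comp (contDiff_fst.prodMk (contDiff_fst.mul contDiff_snd)))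

/-- The overlap of two charts that meet only off the exceptional curves. -/
def overlap (S : Set X) (p q : X) (f : ℂ × ℂ → ℂ × ℂ) (D : Set (ℂ × ℂ)) : Set (ℂ × ℂ) :=
  {w | f w ∈ (chartAt (ℂ × ℂ) p).target ∧
    (chartAt (ℂ × ℂ) p).symm (f w) ∉ S ∧
    (chartAt (ℂ × ℂ) p).symm (f w) ∈ (chartAt (ℂ × ℂ) q).source ∧
    chartAt (ℂ × ℂ) q ((chartAt (ℂ × ℂ) p).symm (f w)) ∈ D}

/-- Two charts that meet only off the exceptional curves are compatible. -/
theorem compatible_aux {n : WithTop ℕ∞} [IsManifold 𝓘(ℂ, ℂ × ℂ) n X] (hS : IsClosed S)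
    (p q : X) {f g : ℂ × ℂ → ℂ × ℂ} (D : Set (ℂ × ℂ)) (hD : IsOpen D)
    (hf : ContDiff ℂ n f) (hg : ContDiffOn ℂ n g D) :
    IsOpen (overlap S p q f D) ∧
    ContDiffOn ℂ n (fun w => g (chartAt (ℂ × ℂ) q ((chartAt (ℂ × ℂ) p).symm (f w))))
      (overlap S p q f D) := by
  set c := chartAt (ℂ × ℂ) p
  set d := chartAt (ℂ × ℂ) q
  have hcd : ContDiffOn ℂ n (d ∘ c.symm) (c.symm.trans d).source := by
    have := contDiffGroupoid n 𝓘(ℂ, ℂ × ℂ) |>.compatible (chart_mem_atlas _ p) (chart_mem_atlas _ q)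
    simpa [contDiffGroupoid, mem_groupoid_of_pregroupoid, contDiffPregroupoid] using this.1
  constructor
  · have h1 : IsOpen (c.target ∩ c.symm ⁻¹' (Sᶜ ∩ (d.source ∩ d ⁻¹' D))) :=
      c.symm.isOpen_inter_preimage (hS.isOpen_compl.inter (d.isOpen_inter_preimage hD))
    exact h1.preimage hf.continuous
  · refine hg.comp (t := D) (hcd.comp (t := (c.symm.trans d).source) hf.contDiffOn ?_) ?_
    · intro w hw
      simpa using ⟨hw.1, hw.2.2.1⟩
    · intro w hw
      exact hw.2.2.2

theorem contDiffOn_slope {n : WithTop ℕ∞} (i : Bool) (a : ℂ × ℂ) :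
    ContDiffOn ℂ n (fun z => ((flip i (z - a)).1, (flip i (z - a)).2 / (flip i (z - a)).1))
      {z | (flip i (z - a)).1 ≠ 0} := by
  have h : ContDiff ℂ n fun z => flip i (z - a) :=
    (contDiff_flip i).comp (contDiff_id.sub contDiff_const)
  exact (contDiff_fst.comp h).contDiffOn.prodMk
    ((contDiff_snd.comp h).contDiffOn.div (contDiff_fst.comp h).contDiffOn fun _ hz => hz)

theorem isOpen_slope (i : Bool) (a : ℂ × ℂ) : IsOpen {z : ℂ × ℂ | (flip i (z - a)).1 ≠ 0} :=
  isOpen_ne_fun (continuous_fst.comp ((contDiff_flip i (n := 0)).continuous.comp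
    (continuous_id.sub continuous_const))) continuous_const

theorem affineCoord_of_notMem (q : X) (i : Bool) {y : BlowUp X S} (hy : y.pt ∉ S) :
    affineCoord q i y =
      ((flip i (chartAt (ℂ × ℂ) q y.pt - chartAt (ℂ × ℂ) q q)).1,
        (flip i (chartAt (ℂ × ℂ) q y.pt - chartAt (ℂ × ℂ) q q)).2 /
          (flip i (chartAt (ℂ × ℂ) q y.pt - chartAt (ℂ × ℂ) q q)).1) := by
  rw [affineCoord, lineRep, dif_neg hy]

theorem mem_affineSource_of_notMem (q : X) (i : Bool) {y : BlowUp X S} (hy : y.pt ∉ S) :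
    y ∈ affineSource S q i ↔ y.pt ∈ (chartAt (ℂ × ℂ) q).source ∧
      (flip i (chartAt (ℂ × ℂ) q y.pt - chartAt (ℂ × ℂ) q q)).1 ≠ 0 := by
  have : y.pt ∉ S \ {q} := fun h => hy h.1
  simp only [affineSource, Set.mem_ofPred_eq, lineRep, dif_neg hy, this, not_false_iff, true_and]

theorem isOpen_affineTarget [T1Space X] [Finite S] (p : X) (i : Bool) :
    IsOpen (affineTarget S p i) := by
  have hS : IsClosed (S \ {p}) := ((Set.toFinite S).subset Set.sdiff_subset).isClosed
  exact ((chartAt (ℂ × ℂ) p).symm.isOpen_inter_preimage hS.isOpen_compl).preimage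
    (contDiff_affineDown p i (n := 0)).continuous

/-- All charts of the blowup are compatible. -/
theorem compatible [T1Space X] [Finite S] {n : WithTop ℕ∞} [IsManifold 𝓘(ℂ, ℂ × ℂ) n X]
    {e e' : PartialEquiv (BlowUp X S) (ℂ × ℂ)}
    (he : e ∈ blowUpAtlas X S) (he' : e' ∈ blowUpAtlas X S) :
    IsOpen (e.symm.trans e').source ∧ ContDiffOn ℂ n (e.symm.trans e') (e.symm.trans e').source := by
  have hS : IsClosed S := (Set.toFinite S).isClosed
  rcases he with ⟨p, rfl⟩ | ⟨⟨p, i⟩, rfl⟩ <;> rcases he' with ⟨q, rfl⟩ | ⟨⟨q, j⟩, rfl⟩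
  · obtain ⟨h1, h2⟩ := compatible_aux (n := n) hS p q Set.univ isOpen_univ contDiff_id
      contDiffOn_id
    have hs : ((regularChart S p).symm.trans (regularChart S q)).source = overlap S p q id Set.univ := by
      ext w
      change (_ ∧ _) ∧ _ ∧ _ ↔ _ ∧ _ ∧ _ ∧ _
      simp only [id, Set.mem_univ, and_true]
      exact ⟨fun h => ⟨h.1.1, h.1.2, h.2.1⟩, fun h => ⟨⟨h.1, h.2.1⟩, h.2.2, h.2.1⟩⟩
    rw [hs]
    exact ⟨h1, h2⟩
  · obtain ⟨h1, h2⟩ := compatible_aux (n := n) hS p q _ (isOpen_slope j (chartAt (ℂ × ℂ) (q : X) q))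
      contDiff_id (contDiffOn_slope j (chartAt (ℂ × ℂ) (q : X) q))
    have hs : ((regularChart S p).symm.trans (affineChart q j)).source =
        overlap S p q id {z | (flip j (z - chartAt (ℂ × ℂ) (q : X) q)).1 ≠ 0} := by
      ext w
      change (_ ∧ _) ∧ _ ↔ _ ∧ _ ∧ _ ∧ _
      constructor
      · rintro ⟨⟨h1, h2⟩, h3⟩
        exact ⟨h1, h2, (mem_affineSource_of_notMem _ _ h2).1 h3⟩
      · rintro ⟨h1, h2, h3⟩
        exact ⟨⟨h1, h2⟩, (mem_affineSource_of_notMem _ _ h2).2 h3⟩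
    rw [hs]
    refine ⟨h1, h2.congr fun w hw => ?_⟩
    exact affineCoord_of_notMem _ _ hw.2.1
  · obtain ⟨h1, h2⟩ := compatible_aux (n := n) hS (p : X) q Set.univ isOpen_univ
      (contDiff_affineDown (p : X) i) contDiffOn_id
    have hs : ((affineChart p i).symm.trans (regularChart S q)).source =
        overlap S (p : X) q (affineDown (p : X) i) Set.univ := by
      ext w
      change (_ ∧ _) ∧ _ ∧ _ ↔ _ ∧ _ ∧ _ ∧ _
      simp only [Set.mem_univ, and_true]
      exact ⟨fun h => ⟨h.1.1, h.2.2, h.2.1⟩,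
        fun h => ⟨⟨h.1, fun h' => h.2.1 h'.1⟩, h.2.2, h.2.1⟩⟩
    rw [hs]
    exact ⟨h1, h2⟩
  · by_cases hpq : p = q
    · subst hpq
      by_cases hij : i = j
      · subst hij
        have hs : ((affineChart p i).symm.trans (affineChart p i)).source =
            affineTarget S (p : X) i := by
          ext w
          exact ⟨fun h => h.1, fun h => ⟨h, (affineChart p i).map_target h⟩⟩
        rw [hs]
        refine ⟨isOpen_affineTarget _ _, contDiffOn_id.congr fun w hw => ?_⟩
        exact (affineChart p i).right_inv hw
      · have hfl : ∀ v : ℂ, flip j (flip i (1, v)) = (v, 1) := by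
          intro v
          cases i <;> cases j <;> first | rfl | exact absurd rfl hij
        have hfl' : ∀ z : ℂ × ℂ, flip j (flip i z) = (z.2, z.1) := by
          intro v
          cases i <;> cases j <;> first | rfl | exact absurd rfl hij
        have hs : ((affineChart p i).symm.trans (affineChart p j)).source =
            affineTarget S (p : X) i ∩ {w | w.2 ≠ 0} := by
          ext w
          constructor
          · rintro ⟨h1, h2⟩
            refine ⟨h1, ?_⟩
            obtain ⟨a, ha, h⟩ := exists_lineRep_affineInv (p : X) i p.2 h1
            have h3 : (flip j (lineRep (p : X) (affineInv S (p : X) i w))).1 ≠ 0 := h2.2.2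
            rw [h, flip_smul, hfl] at h3
            exact right_ne_zero_of_mul h3
          · rintro ⟨h1, h2⟩
            refine ⟨h1, ((affineChart p i).map_target h1).1, h1.2, ?_⟩
            obtain ⟨a, ha, h⟩ := exists_lineRep_affineInv (p : X) i p.2 h1
            change (flip j (lineRep (p : X) (affineInv S (p : X) i w))).1 ≠ 0
            rw [h, flip_smul, hfl]
            exact mul_ne_zero ha h2
        rw [hs]
        refine ⟨(isOpen_affineTarget _ _).inter (isOpen_ne_fun continuous_snd continuous_const), ?_⟩
        have hc : ContDiffOn ℂ n (fun w : ℂ × ℂ => (w.1 * w.2, 1 / w.2))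
            (affineTarget S (p : X) i ∩ {w | w.2 ≠ 0}) :=
          (contDiff_fst.mul contDiff_snd).contDiffOn.prodMk
            (contDiffOn_const.div contDiff_snd.contDiffOn fun _ hw => hw.2)
        refine hc.congr fun w hw => ?_
        obtain ⟨a, ha, h⟩ := exists_lineRep_affineInv (p : X) i p.2 hw.1
        change affineCoord (p : X) j (affineInv S (p : X) i w) = _
        refine Prod.ext ?_ ?_
        · change (flip j (chartAt (ℂ × ℂ) (p : X)
            ((chartAt (ℂ × ℂ) (p : X)).symm (affineDown (p : X) i w)) - _)).1 = _
          rw [(chartAt (ℂ × ℂ) (p : X)).right_inv hw.1.1, affineDown, add_sub_cancel_left, hfl']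
        · change _ / _ = _
          rw [h, flip_smul, hfl]
          change a * 1 / (a * w.2) = 1 / w.2
          exact mul_div_mul_left _ _ ha
    · have hpq' : (p : X) ≠ q := fun h => hpq (Subtype.ext h)
      obtain ⟨h1, h2⟩ := compatible_aux (n := n) hS (p : X) q _
        (isOpen_slope j (chartAt (ℂ × ℂ) (q : X) q))
        (contDiff_affineDown (p : X) i) (contDiffOn_slope j (chartAt (ℂ × ℂ) (q : X) q))
      have hs : ((affineChart p i).symm.trans (affineChart q j)).source =
          overlap S (p : X) q (affineDown (p : X) i)
            {z | (flip j (z - chartAt (ℂ × ℂ) (q : X) q)).1 ≠ 0} := by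
        ext w
        change (_ ∧ _) ∧ _ ↔ _ ∧ _ ∧ _ ∧ _
        constructor
        · rintro ⟨⟨h1, h2⟩, h3⟩
          have h4 : (affineInv S (p : X) i w).pt ∉ S := by
            intro hmem
            have e1 : (affineInv S (p : X) i w).pt = p := by
              by_contra hne
              exact h2 ⟨hmem, hne⟩
            have e2 : (affineInv S (p : X) i w).pt = q := by
              by_contra hne
              exact h3.2.1 ⟨hmem, hne⟩
            exact hpq' (e1.symm.trans e2)
          exact ⟨h1, h4, (mem_affineSource_of_notMem _ _ h4).1 h3⟩
        · rintro ⟨h1, h2, h3⟩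
          exact ⟨⟨h1, fun h' => h2 h'.1⟩, (mem_affineSource_of_notMem _ _ h2).2 h3⟩
      rw [hs]
      refine ⟨h1, h2.congr fun w hw => ?_⟩
      exact affineCoord_of_notMem _ _ hw.2.1

/-- The charts of the blowup of `X` at the finite set `S`. -/
noncomputable def chartedSpaceCore (X : Type*) [TopologicalSpace X] [T1Space X]
    [ChartedSpace (ℂ × ℂ) X] (S : Set X) [Finite S] :
    ChartedSpaceCore (ℂ × ℂ) (BlowUp X S) where
  atlas := blowUpAtlas X S
  chartAt := blowUpChartAt
  mem_chart_source y := by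
    unfold blowUpChartAt
    split_ifs with h
    · refine ⟨mem_chart_source _ _, fun h' => h'.2 rfl, ?_⟩
      have hne : lineRep y.pt y ≠ 0 := by
        rw [lineRep, dif_pos h]
        exact Projectivization.rep_nonzero _
      by_cases h0 : (lineRep y.pt y).1 = 0
      · simp only [h0, decide_true, flip]
        exact fun h1 => hne (Prod.ext h0 h1)
      · simp only [h0, decide_false, flip]
        exact h0
    · exact ⟨mem_chart_source _ _, h⟩
  chart_mem_atlas y := by
    unfold blowUpChartAt
    split_ifs with h
    · exact Or.inr ⟨(_, _), rfl⟩
    · exact Or.inl ⟨_, rfl⟩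
  open_source _ _ he he' := (compatible (n := 0) he he').1
  continuousOn_toFun _ _ he he' := (compatible (n := 0) he he').2.continuousOn

variable (X S)

/-- The topology of the blowup. -/
noncomputable instance instTopologicalSpace [T1Space X] [Finite S] :
    TopologicalSpace (BlowUp X S) :=
  (chartedSpaceCore X S).toTopologicalSpace

/-- The complex structure of the blowup. -/
noncomputable instance instChartedSpace [T1Space X] [Finite S] :
    ChartedSpace (ℂ × ℂ) (BlowUp X S) :=
  (chartedSpaceCore X S).toChartedSpace

/-- The blowup of a complex surface at finitely many points is a complex manifold. -/
instance instIsManifold [T1Space X] [Finite S] [IsManifold 𝓘(ℂ, ℂ × ℂ) ω X] :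
    IsManifold 𝓘(ℂ, ℂ × ℂ) ω (BlowUp X S) := by
  apply isManifold_of_contDiffOn
  intro e e' he he'
  replace he : e ∈ ⋃ (c : PartialEquiv (BlowUp X S) (ℂ × ℂ)) (hc : c ∈ blowUpAtlas X S),
      {(chartedSpaceCore X S).openPartialHomeomorph c hc} := he
  replace he' : e' ∈ ⋃ (c : PartialEquiv (BlowUp X S) (ℂ × ℂ)) (hc : c ∈ blowUpAtlas X S),
      {(chartedSpaceCore X S).openPartialHomeomorph c hc} := he'
  simp only [Set.mem_iUnion, Set.mem_singleton_iff] at he he'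
  obtain ⟨c, hc, rfl⟩ := he
  obtain ⟨c', hc', rfl⟩ := he'
  have h := (compatible (n := ω) hc hc').2
  simp only [modelWithCornersSelf_coe, modelWithCornersSelf_coe_symm, Function.comp_id,
    Set.preimage_id, Set.range_id, Set.inter_univ, Function.id_comp]
  exact h

end BlowUp

/-! ### The coverings of the product of two elliptic curves -/

namespace EisensteinCover

/-- `ζ = exp (π i / 3)`. -/
noncomputable def zeta : ℂ := Complex.exp (Real.pi * Complex.I / 3)

/-- `ρ = ζ²`, a primitive third root of unity. -/
noncomputable def rho : ℂ := zeta ^ 2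

theorem zeta_eq : zeta = ⟨1 / 2, √3 / 2⟩ := by
  have : (Real.pi * Complex.I / 3 : ℂ) = ((Real.pi / 3 : ℝ) : ℂ) * Complex.I := by
    push_cast
    ring
  rw [zeta, this, Complex.exp_mul_I, ← Complex.ofReal_cos, ← Complex.ofReal_sin,
    Real.cos_pi_div_three, Real.sin_pi_div_three]
  apply Complex.ext <;> simp

theorem rho_eq : rho = ⟨-1 / 2, √3 / 2⟩ := by
  have h3 : √3 * √3 = 3 := Real.mul_self_sqrt (by norm_num)
  rw [rho, zeta_eq, sq]
  apply Complex.ext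
  · simp only [Complex.mul_re]
    nlinarith
  · simp only [Complex.mul_im]
    ring

/-- The lattice `ℤ[ρ]` in `ℂ`. -/
noncomputable def latticeE : AddSubgroup ℂ := AddSubgroup.closure {1, rho}

/-- The elliptic curve `E = ℂ / ℤ[ρ]`. -/
abbrev E : Type := ℂ ⧸ latticeE

/-- The generators `v₁, v₂, v₃, v₄` of the fundamental group `ℤ[ρ] × ℤ[ρ]` of `A = E × E`. -/
noncomputable def gen : Fin 4 → ℂ × ℂ := ![(1, 0), (rho, 0), (0, 1), (0, rho)]

/-- The identification of the free abelian group on `v₁, v₂, v₃, v₄` with the lattice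
`ℤ[ρ] × ℤ[ρ]` in `ℂ²`. -/
noncomputable def period : (Fin 4 → ℤ) →+ ℂ × ℂ :=
  (Fintype.linearCombination ℤ gen).toAddMonoidHom

/-- The homomorphism `σ_{n, j}` from the fundamental group of `A` to `ℤ / 3ⁿ` (written additively)
with `v₁, v₂ ↦ δ` and `v₃, v₄ ↦ j δ`. -/
def sigma (n : ℕ) (δ : ZMod (3 ^ n)) (j : ℕ) : (Fin 4 → ℤ) →+ ZMod (3 ^ n) :=
  (Fintype.linearCombination ℤ ![δ, δ, j • δ, j • δ]).toAddMonoidHom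

/-- The kernel `K_{n, j}` of `σ_{n, j}`, as a lattice in `ℂ²`. -/
noncomputable def kernel (n : ℕ) (δ : ZMod (3 ^ n)) (j : ℕ) : AddSubgroup (ℂ × ℂ) :=
  (sigma n δ j).ker.map period

/-- The covering torus `A_{n, j} = ℂ² / K_{n, j}` of `A`. -/
abbrev Cover (n : ℕ) (δ : ZMod (3 ^ n)) (j : ℕ) : Type := (ℂ × ℂ) ⧸ kernel n δ j

theorem period_apply (a : Fin 4 → ℤ) : period a = (a 0 + a 1 * rho, a 2 + a 3 * rho) := by
  change Fintype.linearCombination ℤ gen a = _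
  rw [Fintype.linearCombination_apply, Fin.sum_univ_four]
  simp [gen]

theorem sigma_apply (n : ℕ) (δ : ZMod (3 ^ n)) (j : ℕ) (a : Fin 4 → ℤ) :
    sigma n δ j a = a 0 * δ + a 1 * δ + a 2 * (j * δ) + a 3 * (j * δ) := by
  change Fintype.linearCombination ℤ _ a = _
  rw [Fintype.linearCombination_apply, Fin.sum_univ_four]
  simp

theorem intCast_add_mul_rho_mem (a b : ℤ) : (a + b * rho : ℂ) ∈ latticeE := by
  have h1 : (1 : ℂ) ∈ latticeE := AddSubgroup.subset_closure (by simp)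
  have h2 : rho ∈ latticeE := AddSubgroup.subset_closure (by simp)
  simpa using latticeE.add_mem (latticeE.zsmul_mem h1 a) (latticeE.zsmul_mem h2 b)

theorem exists_of_mem_latticeE {z : ℂ} (hz : z ∈ latticeE) : ∃ a b : ℤ, z = a + b * rho := by
  obtain ⟨a, b, h⟩ := AddSubgroup.mem_closure_pair.mp hz
  exact ⟨a, b, by simpa using h.symm⟩

theorem eq_zero_of_norm_lt {a b : ℤ} (h : ‖(a + b * rho : ℂ)‖ < 1 / 2) : a = 0 ∧ b = 0 := by
  have h3 : √3 * √3 = 3 := Real.mul_self_sqrt (by norm_num)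
  have h3' : 0 ≤ √3 := Real.sqrt_nonneg 3
  have him := (Complex.abs_im_le_norm (a + b * rho : ℂ)).trans_lt h
  have hre := (Complex.abs_re_le_norm (a + b * rho : ℂ)).trans_lt h
  simp only [rho_eq, Complex.add_im, Complex.add_re, Complex.mul_im, Complex.mul_re,
    Complex.intCast_re, Complex.intCast_im, zero_mul, sub_zero, zero_add, add_zero] at him hre
  have hb : b = 0 := by
    have h1 : |(b : ℝ)| < 1 := by
      rw [abs_lt] at him ⊢
      constructor <;> nlinarith
    exact Int.abs_lt_one_iff.mp (by exact_mod_cast h1)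
  subst hb
  refine ⟨?_, rfl⟩
  have h1 : |(a : ℝ)| < 1 := by
    simp only [Int.cast_zero, zero_mul, add_zero] at hre
    linarith
  exact Int.abs_lt_one_iff.mp (by exact_mod_cast h1)

instance instDiscreteTopology (n : ℕ) (δ : ZMod (3 ^ n)) (j : ℕ) :
    DiscreteTopology (kernel n δ j) := by
  apply discreteTopology_of_isOpen_singleton_zero
  refine isOpen_induced_iff.mpr ⟨Metric.ball 0 (1 / 2), Metric.isOpen_ball, ?_⟩
  ext ⟨x, hx⟩
  simp only [Set.mem_preimage, mem_ball_zero_iff, Set.mem_singleton_iff]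
  constructor
  · intro h
    obtain ⟨a, -, rfl⟩ := hx
    simp only [period_apply, Prod.norm_def, max_lt_iff] at h
    obtain ⟨h0, h1⟩ := eq_zero_of_norm_lt h.1
    obtain ⟨h2, h3⟩ := eq_zero_of_norm_lt h.2
    apply Subtype.ext
    change period a = 0
    simp [period_apply, h0, h1, h2, h3]
  · intro h
    have : x = 0 := congrArg Subtype.val h
    simp [this]

/-- The covering homomorphism `s_{n, j} : A_{n, j} → A = E × E`, induced by the identity of
`ℂ²`. -/
noncomputable def cover (n : ℕ) (δ : ZMod (3 ^ n)) (j : ℕ) : Cover n δ j →+ E × E :=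
  QuotientAddGroup.lift (kernel n δ j)
    ((QuotientAddGroup.mk' latticeE).prodMap (QuotientAddGroup.mk' latticeE)) <| by
      rintro _ ⟨a, -, rfl⟩
      rw [period_apply]
      exact Prod.ext ((QuotientAddGroup.eq_zero_iff _).2 (intCast_add_mul_rho_mem _ _))
        ((QuotientAddGroup.eq_zero_iff _).2 (intCast_add_mul_rho_mem _ _))

/-- The set `s_{n, j}⁻¹([0, 0])` of points of `A_{n, j}` over the origin of `A`. -/
noncomputable def overOrigin (n : ℕ) (δ : ZMod (3 ^ n)) (j : ℕ) : Set (Cover n δ j) :=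
  cover n δ j ⁻¹' {(0, 0)}

instance instFinite (n : ℕ) (δ : ZMod (3 ^ n)) (j : ℕ) : Finite (overOrigin n δ j) := by
  have h : ∀ x ∈ overOrigin n δ j, ∃ a, QuotientAddGroup.mk (period a) = x := by
    intro x hx
    obtain ⟨⟨z, w⟩, rfl⟩ := QuotientAddGroup.mk_surjective x
    have hx' : ((z : E), (w : E)) = (0, 0) := hx
    rw [Prod.mk.injEq, QuotientAddGroup.eq_zero_iff, QuotientAddGroup.eq_zero_iff] at hx'
    obtain ⟨a, b, rfl⟩ := exists_of_mem_latticeE hx'.1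
    obtain ⟨c, d, rfl⟩ := exists_of_mem_latticeE hx'.2
    exact ⟨![a, b, c, d], by rw [period_apply]; rfl⟩
  choose! a ha using h
  have : NeZero (3 ^ n) := ⟨by positivity⟩
  refine Finite.of_injective (fun x : overOrigin n δ j => sigma n δ j (a x)) ?_
  intro x y hxy
  apply Subtype.ext
  rw [← ha x x.2, ← ha y y.2, QuotientAddGroup.eq]
  refine ⟨-a x + a y, ?_, by simp⟩
  have hxy' : sigma n δ j (a x) = sigma n δ j (a y) := hxy
  simp [AddMonoidHom.mem_ker, hxy']

/-- The surface `A*_{n, j}`: the blowup of `A_{n, j}` at the points over the origin of `A`. -/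
abbrev CoverBlowUp (n : ℕ) (δ : ZMod (3 ^ n)) (j : ℕ) : Type :=
  BlowUp (Cover n δ j) (overOrigin n δ j)

/-- The shear of `ℂ²` with matrix `(1 r; 0 1)`. -/
def shear (r : ℤ) : (ℂ × ℂ) →+ ℂ × ℂ where
  toFun z := (z.1 + r * z.2, z.2)
  map_zero' := by simp
  map_add' z w := Prod.ext (by simp only [Prod.fst_add, Prod.snd_add]; ring) rfl

end EisensteinCover

/-! ### Maps that are affine in the preferred charts -/

/-! In the coordinates of the free abelian group on v₁, v₂, v₃, v₄, the shear f with integer r adds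
r times the third and fourth coordinates to the first and second. So it preserves ℤ[ρ] × ℤ[ρ], and
it turns the coefficient kδ of `sigma n δ k` on v₃ and v₄ into (r + k)δ = jδ. Hence σ_{n,k} ∘ f =
σ_{n,j} (`sigma_shear`). The same argument for -r gives the reverse inclusion of kernels
(`map_shear_kernel`), so f descends to an isomorphism of the tori that matches the points over the
origin. These points form (ℤ[ρ] × ℤ[ρ]) / K_{n,j}, which σ_{n,j} identifies with ℤ/3ⁿ because
σ_{n,j}(v₁) = δ is a generator (`ncard_overOrigin`).

For the blowups, directions are recorded in the preferred charts. Charts of a torus are local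
inverses of the projection from ℂ², so the descended map is affine in preferred charts, with the
same linear part A = f at every point (`ComplexTorus.isLocallyAffine`). The derivative therefore
acts on directions through A, and this defines the lift. Off the exceptional curves the lift is the
map of tori. Near them it sends (u, v) to (u m, m' / m), where A(1, v) = (m, m') up to exchanging
coordinates, which is analytic where m ≠ 0 (`contMDiffAt_map_of_mem`). The inverse lifts in the same
way. -/

open Filter Topology in
/-- A map which in a pair of charts around `x` and its image is given by a `C^n` map `g` is `C^n`
at `x`. -/
theorem contMDiffAt_of_eventually_chart_symm {V M N : Type*} [NormedAddCommGroup V]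
    [NormedSpace ℂ V] [TopologicalSpace M] [ChartedSpace V M] [TopologicalSpace N]
    [ChartedSpace V N] {n : WithTop ℕ∞}
    {e : OpenPartialHomeomorph M V} (he : e ∈ IsManifold.maximalAtlas 𝓘(ℂ, V) n M)
    {e' : OpenPartialHomeomorph N V} (he' : e' ∈ IsManifold.maximalAtlas 𝓘(ℂ, V) n N)
    [IsManifold 𝓘(ℂ, V) n M] [IsManifold 𝓘(ℂ, V) n N]
    {F : M → N} {x : M} (hx : x ∈ e.source) {g : V → V} (hg : ContDiffAt ℂ n g (e x))
    (hgx : g (e x) ∈ e'.target) (h : ∀ᶠ w in 𝓝 (e x), F (e.symm w) = e'.symm (g w)) :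
    ContMDiffAt 𝓘(ℂ, V) 𝓘(ℂ, V) n F x := by
  have h1 : ContMDiffAt 𝓘(ℂ, V) 𝓘(ℂ, V) n e x := contMDiffAt_of_mem_maximalAtlas he hx
  have h2 : ContMDiffAt 𝓘(ℂ, V) 𝓘(ℂ, V) n e'.symm (g (e x)) :=
    contMDiffAt_symm_of_mem_maximalAtlas he' hgx
  have h3 : ContMDiffAt 𝓘(ℂ, V) 𝓘(ℂ, V) n (e'.symm ∘ g ∘ e) x :=
    h2.comp x (hg.contMDiffAt.comp x h1)
  refine h3.congr_of_eventuallyEq ?_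
  filter_upwards [(e.continuousAt hx).eventually h, e.open_source.mem_nhds hx] with y hy hys
  rw [e.left_inv hys] at hy
  exact hy

/-! ### Linear automorphisms acting on directions -/

namespace Projectivization

theorem map_mk_eq_mk_of_smul {A : (ℂ × ℂ) ≃ₗ[ℂ] ℂ × ℂ} {v : ℂ × ℂ} (hv : v ≠ 0) {w : ℂ × ℂ} (hw : w ≠ 0)
    {c : ℂ} (h : A v = c • w) :
    map (A : (ℂ × ℂ) →ₗ[ℂ] ℂ × ℂ) A.injective (mk ℂ v hv) =
      mk ℂ w hw := by
  rw [map_mk, mk_eq_mk_iff']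
  exact ⟨c, h.symm⟩

theorem map_symm_map (A : (ℂ × ℂ) ≃ₗ[ℂ] ℂ × ℂ) (l : ℙ ℂ (ℂ × ℂ)) :
    map (A.symm : (ℂ × ℂ) →ₗ[ℂ] ℂ × ℂ) A.symm.injective
      (map (A : (ℂ × ℂ) →ₗ[ℂ] ℂ × ℂ) A.injective l) = l := by
  induction l using ind with
  | h v hv => simp [map_mk]

end Projectivization

section

variable {X Y : Type*} [TopologicalSpace X] [ChartedSpace (ℂ × ℂ) X]
  [TopologicalSpace Y] [ChartedSpace (ℂ × ℂ) Y]

open Topology in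
/-- `φ` is near every point `p`, in the preferred charts at `p` and `φ p`, affine with linear
part `A`. -/
def IsLocallyAffine (φ : X → Y) (A : (ℂ × ℂ) ≃ₗ[ℂ] ℂ × ℂ) : Prop :=
  ∀ p : X, ∀ᶠ z in 𝓝 (0 : ℂ × ℂ),
    φ ((chartAt (ℂ × ℂ) p).symm (chartAt (ℂ × ℂ) p p + z)) =
      (chartAt (ℂ × ℂ) (φ p)).symm (chartAt (ℂ × ℂ) (φ p) (φ p) + A z)

theorem LinearEquiv.contDiff_complex_prod (A : (ℂ × ℂ) ≃ₗ[ℂ] ℂ × ℂ) {n : WithTop ℕ∞} :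
    ContDiff ℂ n A :=
  A.toContinuousLinearEquiv.contDiff

open Topology in
theorem IsLocallyAffine.eventually {φ : X → Y} {A : (ℂ × ℂ) ≃ₗ[ℂ] ℂ × ℂ}
    (h : IsLocallyAffine φ A) (p : X) :
    ∀ᶠ w in 𝓝 (chartAt (ℂ × ℂ) p p), φ ((chartAt (ℂ × ℂ) p).symm w) =
      (chartAt (ℂ × ℂ) (φ p)).symm
        (chartAt (ℂ × ℂ) (φ p) (φ p) + A (w - chartAt (ℂ × ℂ) p p)) := by
  have hc : Filter.Tendsto (fun w => w - chartAt (ℂ × ℂ) p p) (𝓝 (chartAt (ℂ × ℂ) p p)) (𝓝 0) := by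
    have : ContinuousAt (fun w => w - chartAt (ℂ × ℂ) p p) (chartAt (ℂ × ℂ) p p) :=
      continuousAt_id.sub continuousAt_const
    simpa [ContinuousAt] using this
  filter_upwards [hc.eventually (h p)] with w hw
  rwa [add_sub_cancel] at hw

theorem contDiff_affine_chart (A : (ℂ × ℂ) ≃ₗ[ℂ] ℂ × ℂ) (a b : ℂ × ℂ) {n : WithTop ℕ∞} :
    ContDiff ℂ n fun w => b + A (w - a) :=
  contDiff_const.add (A.contDiff_complex_prod.comp (contDiff_id.sub contDiff_const))

/-- Affine maps are analytic, and the one at `p` sends the coordinates of `p` to those of `φ p`,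
hence into the target of the second chart. -/
theorem IsLocallyAffine.contMDiff {φ : X → Y} {A : (ℂ × ℂ) ≃ₗ[ℂ] ℂ × ℂ}
    (h : IsLocallyAffine φ A) [IsManifold 𝓘(ℂ, ℂ × ℂ) ω X] [IsManifold 𝓘(ℂ, ℂ × ℂ) ω Y] :
    ContMDiff 𝓘(ℂ, ℂ × ℂ) 𝓘(ℂ, ℂ × ℂ) ω φ := fun p =>
  contMDiffAt_of_eventually_chart_symm (IsManifold.chart_mem_maximalAtlas p)
    (IsManifold.chart_mem_maximalAtlas (φ p)) (mem_chart_source _ p)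
    (contDiff_affine_chart A _ _).contDiffAt (by simp) (h.eventually p)

/-! ### Lifting locally affine maps to blowups -/

namespace BlowUp

variable {S : Set X} {T : Set Y}

/-- The map of blowups which lies over `φ` and acts by `A` on the directions. -/
noncomputable def map (φ : X → Y) (A : (ℂ × ℂ) ≃ₗ[ℂ] ℂ × ℂ) (hφ : ∀ x, φ x ∈ T → x ∈ S) (y : BlowUp X S) :
    BlowUp Y T :=
  ⟨φ y.pt, fun h =>
    Projectivization.map (A : (ℂ × ℂ) →ₗ[ℂ] ℂ × ℂ) A.injective (y.dir (hφ _ h))⟩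

/-- A linear automorphism of `ℂ²` in affine coordinates of the blowup of the origin. -/
noncomputable def linearCoord (A : (ℂ × ℂ) ≃ₗ[ℂ] ℂ × ℂ) (i j : Bool) (w : ℂ × ℂ) : ℂ × ℂ :=
  (w.1 * (flip j (A (flip i (1, w.2)))).1,
    (flip j (A (flip i (1, w.2)))).2 / (flip j (A (flip i (1, w.2)))).1)

theorem contDiff_flip_map (A : (ℂ × ℂ) ≃ₗ[ℂ] ℂ × ℂ) (i j : Bool) {n : WithTop ℕ∞} :
    ContDiff ℂ n fun w : ℂ × ℂ => flip j (A (flip i (1, w.2))) :=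
  (contDiff_flip j).comp (A.contDiff_complex_prod.comp
    ((contDiff_flip i).comp (contDiff_const.prodMk contDiff_snd)))

theorem contDiffAt_linearCoord {A : (ℂ × ℂ) ≃ₗ[ℂ] ℂ × ℂ} {i j : Bool} {w : ℂ × ℂ}
    (h : (flip j (A (flip i (1, w.2)))).1 ≠ 0) {n : WithTop ℕ∞} :
    ContDiffAt ℂ n (linearCoord A i j) w := by
  have h1 := (contDiff_fst.comp (contDiff_flip_map A i j (n := n))).contDiffAt (x := w)
  have h2 := (contDiff_snd.comp (contDiff_flip_map A i j (n := n))).contDiffAt (x := w)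
  exact (contDiffAt_fst.mul h1).prodMk (h2.div h1 h)

/-- This is the covering of the projective line by its two affine charts; it selects the chart at a
given direction. -/
theorem exists_flip_fst_ne_zero {z : ℂ × ℂ} (hz : z ≠ 0) : ∃ j, (flip j z).1 ≠ 0 := by
  by_contra! h
  exact hz (Prod.ext (h false) (h true))

/-- Rescaling the image of (1, v) to have first coordinate 1 leaves the new slope as second
coordinate. So the second component of `linearCoord` is the action of `A` on directions. -/
theorem map_flip_eq_smul {A : (ℂ × ℂ) ≃ₗ[ℂ] ℂ × ℂ} {i j : Bool} {w : ℂ × ℂ}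
    (h : (flip j (A (flip i (1, w.2)))).1 ≠ 0) :
    A (flip i (1, w.2)) =
      (flip j (A (flip i (1, w.2)))).1 • flip j (1, (linearCoord A i j w).2) := by
  rw [← flip_smul]
  conv_lhs => rw [← flip_flip j (A (flip i (1, w.2)))]
  congr 1
  refine Prod.ext (mul_one _).symm ?_
  exact (mul_div_cancel₀ _ h).symm

/-- Since (u, uv) = u (1, v), linearity reduces this to the image of (1, v). It says that the
blowdown intertwines `linearCoord` with `A`, also at u = 0. -/
theorem flip_linearCoord {A : (ℂ × ℂ) ≃ₗ[ℂ] ℂ × ℂ} {i j : Bool} {w : ℂ × ℂ}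
    (h : (flip j (A (flip i (1, w.2)))).1 ≠ 0) :
    flip j ((linearCoord A i j w).1, (linearCoord A i j w).1 * (linearCoord A i j w).2) =
      A (flip i (w.1, w.1 * w.2)) := by
  have h1 : ∀ (k : Bool) (u v : ℂ), flip k (u, u * v) = u • flip k (1, v) := by
    intro k u v
    rw [← flip_smul]
    simp
  rw [h1, h1, map_smul, map_flip_eq_smul h, smul_smul]
  rfl

theorem exists_mem_affineSource {y : BlowUp X S} (hy : y.pt ∈ S) :
    ∃ i, y ∈ affineSource S y.pt i := by
  have hne : lineRep y.pt y ≠ 0 := by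
    rw [lineRep, dif_pos hy]
    exact Projectivization.rep_nonzero _
  obtain ⟨i, hi⟩ := exists_flip_fst_ne_zero hne
  exact ⟨i, mem_chart_source _ _, fun h => h.2 rfl, hi⟩

/-! ### Analyticity of the lifted map -/

variable [T1Space X] [Finite S] [T1Space Y] [Finite T] [IsManifold 𝓘(ℂ, ℂ × ℂ) ω X]
  [IsManifold 𝓘(ℂ, ℂ × ℂ) ω Y]

/-- This frees the analyticity criterion from the preferred charts of the blowup: the affine charts
at source and image can be chosen to suit the direction. -/
theorem openPartialHomeomorph_mem_maximalAtlas {c : PartialEquiv (BlowUp X S) (ℂ × ℂ)}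
    (hc : c ∈ blowUpAtlas X S) :
    (chartedSpaceCore X S).openPartialHomeomorph c hc ∈
      IsManifold.maximalAtlas 𝓘(ℂ, ℂ × ℂ) ω (BlowUp X S) := by
  apply IsManifold.subset_maximalAtlas
  change _ ∈ ⋃ (c : PartialEquiv (BlowUp X S) (ℂ × ℂ)) (hc : c ∈ blowUpAtlas X S),
      {(chartedSpaceCore X S).openPartialHomeomorph c hc}
  simp only [Set.mem_iUnion, Set.mem_singleton_iff]
  exact ⟨c, hc, rfl⟩

open Topology in
/-- A map of blowups which in a pair of charts is given by a map `g` analytic at a point is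
analytic there. -/
theorem contMDiffAt_of_eventually_symm {c : PartialEquiv (BlowUp X S) (ℂ × ℂ)}
    (hc : c ∈ blowUpAtlas X S) {c' : PartialEquiv (BlowUp Y T) (ℂ × ℂ)}
    (hc' : c' ∈ blowUpAtlas Y T) {F : BlowUp X S → BlowUp Y T} {y : BlowUp X S}
    (hy : y ∈ c.source) {g : ℂ × ℂ → ℂ × ℂ} (hg : ContDiffAt ℂ ω g (c y))
    (hgy : g (c y) ∈ c'.target) (h : ∀ᶠ w in 𝓝 (c y), F (c.symm w) = c'.symm (g w)) :
    ContMDiffAt 𝓘(ℂ, ℂ × ℂ) 𝓘(ℂ, ℂ × ℂ) ω F y :=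
  contMDiffAt_of_eventually_chart_symm (openPartialHomeomorph_mem_maximalAtlas hc)
    (openPartialHomeomorph_mem_maximalAtlas hc') hy hg hgy h

/-- Regular charts carry no direction, so in them the lift is `φ` itself, an affine map. -/
theorem contMDiffAt_map_of_notMem {φ : X → Y} {A : (ℂ × ℂ) ≃ₗ[ℂ] ℂ × ℂ} (h : IsLocallyAffine φ A)
    (hφ : ∀ x, φ x ∈ T → x ∈ S) {y : BlowUp X S} (hy : y.pt ∉ S) :
    ContMDiffAt 𝓘(ℂ, ℂ × ℂ) 𝓘(ℂ, ℂ × ℂ) ω (map φ A hφ) y := by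
  refine contMDiffAt_of_eventually_symm (c := regularChart S y.pt)
    (c' := regularChart T (φ y.pt)) (Or.inl ⟨_, rfl⟩) (Or.inl ⟨_, rfl⟩)
    ⟨mem_chart_source _ _, hy⟩ (contDiff_affine_chart A (chartAt (ℂ × ℂ) y.pt y.pt)
      (chartAt (ℂ × ℂ) (φ y.pt) (φ y.pt))).contDiffAt ?_ ?_
  · change _ + A (chartAt (ℂ × ℂ) y.pt y.pt - _) ∈ _
    rw [sub_self, map_zero, add_zero]
    refine ⟨mem_chart_target _ _, ?_⟩
    rw [(chartAt (ℂ × ℂ) (φ y.pt)).left_inv (mem_chart_source _ _)]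
    exact fun h' => hy (hφ _ h')
  · have hS : IsClosed S := (Set.toFinite S).isClosed
    have hc : ContinuousAt (chartAt (ℂ × ℂ) y.pt).symm (chartAt (ℂ × ℂ) y.pt y.pt) :=
      (chartAt (ℂ × ℂ) y.pt).symm.continuousAt (mem_chart_target _ _)
    have hev := hc.preimage_mem_nhds (hS.isOpen_compl.mem_nhds
      (by rwa [(chartAt (ℂ × ℂ) y.pt).left_inv (mem_chart_source _ _)]))
    change ∀ᶠ w in nhds (chartAt (ℂ × ℂ) y.pt y.pt), _
    filter_upwards [h.eventually y.pt, hev] with w hw hwS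
    -- Nearby points stay off the closed set `S`, so their images are off `T` and there is no
    -- direction to compare.
    exact ext_of hw fun h' _ => absurd (hφ _ h') hwS

/-- With `i` chosen to contain the direction of `y` and `j` to contain its image under `A`, the lift
reads as `linearCoord A i j`, whose denominator does not vanish at `y`. -/
theorem contMDiffAt_map_of_mem {φ : X → Y} {A : (ℂ × ℂ) ≃ₗ[ℂ] ℂ × ℂ} (h : IsLocallyAffine φ A)
    (hφ : ∀ x, φ x ∈ T ↔ x ∈ S) {y : BlowUp X S} (hy : y.pt ∈ S) :
    ContMDiffAt 𝓘(ℂ, ℂ × ℂ) 𝓘(ℂ, ℂ × ℂ) ω (map φ A fun x => (hφ x).1) y := by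
  obtain ⟨i, hi⟩ := exists_mem_affineSource hy
  set w₀ := affineCoord y.pt i y with hw₀
  have hA : A (flip i (1, w₀.2)) ≠ 0 := by simpa using flip_one_ne_zero i w₀.2
  obtain ⟨j, hj⟩ := exists_flip_fst_ne_zero hA
  -- The point `y` lies over the centre of its own chart, so its displacement from the centre is
  -- zero.
  have hw1 : flip i (w₀.1, w₀.1 * w₀.2) = 0 := by
    have := affineDown_affineCoord y.pt i hi
    rwa [affineDown, add_eq_left] at this
  refine contMDiffAt_of_eventually_symm (c := affineChart ⟨y.pt, hy⟩ i)
    (c' := affineChart ⟨φ y.pt, (hφ _).2 hy⟩ j) (Or.inr ⟨(_, _), rfl⟩) (Or.inr ⟨(_, _), rfl⟩)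
    hi (contDiffAt_linearCoord (A := A) (i := i) (j := j) hj) ?_ ?_
  · have hd : affineDown (φ y.pt) j (linearCoord A i j w₀) =
        chartAt (ℂ × ℂ) (φ y.pt) (φ y.pt) := by
      rw [affineDown, flip_linearCoord hj, hw1, map_zero, add_zero]
    change linearCoord A i j w₀ ∈ affineTarget T (φ y.pt) j
    refine ⟨?_, ?_⟩
    · rw [hd]
      exact mem_chart_target _ _
    · rw [hd, (chartAt (ℂ × ℂ) (φ y.pt)).left_inv (mem_chart_source _ _)]
      exact fun h' => h'.2 rfl
  · change ∀ᶠ w in nhds w₀, map φ A _ (affineInv S y.pt i w) =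
      affineInv T (φ y.pt) j (linearCoord A i j w)
    have hc1 : Continuous fun w : ℂ × ℂ => flip i (w.1, w.1 * w.2) :=
      ((contDiff_flip i (n := 0)).comp
        (contDiff_fst.prodMk (contDiff_fst.mul contDiff_snd))).continuous
    -- For `w` near `w₀` the displacement is near 0, where `φ` is affine; `hev2` keeps the
    -- denominator of the new slope nonzero.
    have hev1 := (hc1.tendsto' w₀ 0 hw1).eventually (h y.pt)
    have hev2 := ((contDiff_fst.comp (contDiff_flip_map A i j (n := 0))).continuous.continuousAt
      (x := w₀)).eventually_ne hj
    filter_upwards [hev1, hev2] with w hw hw'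
    refine ext_of ?_ fun _ _ => Projectivization.map_mk_eq_mk_of_smul _ _ (map_flip_eq_smul hw')
    change φ ((chartAt (ℂ × ℂ) y.pt).symm (affineDown y.pt i w)) =
      (chartAt (ℂ × ℂ) (φ y.pt)).symm (affineDown (φ y.pt) j (linearCoord A i j w))
    rw [affineDown, affineDown, flip_linearCoord hw', hw]

theorem contMDiff_map {φ : X → Y} {A : (ℂ × ℂ) ≃ₗ[ℂ] ℂ × ℂ} (h : IsLocallyAffine φ A)
    (hφ : ∀ x, φ x ∈ T ↔ x ∈ S) :
    ContMDiff 𝓘(ℂ, ℂ × ℂ) 𝓘(ℂ, ℂ × ℂ) ω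
      (map φ A fun x => (hφ x).1 : BlowUp X S → BlowUp Y T) := by
  intro y
  by_cases hy : y.pt ∈ S
  · exact contMDiffAt_map_of_mem h hφ hy
  · exact contMDiffAt_map_of_notMem h _ hy

/-- The biholomorphic map of blowups induced by a biholomorphic map which is affine in the
preferred charts and matches the blown up points. -/
noncomputable def diffeomorph (φ : X ≃ Y) (A : (ℂ × ℂ) ≃ₗ[ℂ] ℂ × ℂ) (h : IsLocallyAffine φ A)
    (h' : IsLocallyAffine φ.symm A.symm) (hφ : ∀ x, φ x ∈ T ↔ x ∈ S) :
    BlowUp X S ≃ₘ^ω⟮𝓘(ℂ, ℂ × ℂ), 𝓘(ℂ, ℂ × ℂ)⟯ BlowUp Y T where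
  toFun := map φ A fun x => (hφ x).1
  invFun := map φ.symm A.symm fun x hx => by
    rw [← φ.apply_symm_apply x]
    exact (hφ _).2 hx
  left_inv y := by
    refine ext_of (φ.symm_apply_apply _) fun _ hy => ?_
    exact Projectivization.map_symm_map A (y.dir hy)
  right_inv y := by
    refine ext_of (φ.apply_symm_apply _) fun _ hy => ?_
    exact Projectivization.map_symm_map A.symm (y.dir hy)
  contMDiff_toFun := contMDiff_map h hφ
  contMDiff_invFun := contMDiff_map h' fun x => by
    rw [← hφ, φ.apply_symm_apply]

end BlowUp

end

/-! ### Linear maps between complex tori -/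

namespace ComplexTorus

/-- The preferred charts are local inverses of the projection, and the total function underlying
their inverse is the projection, even off the chart's target. -/
theorem chartAt_symm (L : AddSubgroup (ℂ × ℂ)) [DiscreteTopology L] (p : (ℂ × ℂ) ⧸ L) :
    ((chartAt (ℂ × ℂ) p).symm : ℂ × ℂ → (ℂ × ℂ) ⧸ L) = QuotientAddGroup.mk :=
  (isLocalHomeomorph_mk L).localInverseAt_symm _

theorem isLocallyAffine {L M : AddSubgroup (ℂ × ℂ)} [DiscreteTopology L] [DiscreteTopology M]
    {φ : (ℂ × ℂ) ⧸ L → (ℂ × ℂ) ⧸ M} {A : (ℂ × ℂ) ≃ₗ[ℂ] ℂ × ℂ}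
    (h : ∀ z : ℂ × ℂ, φ (QuotientAddGroup.mk z) = QuotientAddGroup.mk (A z)) :
    IsLocallyAffine φ A := by
  -- No smallness of `z` is needed: by additivity both sides equal φ(p) + [A z].
  refine fun p => Filter.Eventually.of_forall fun z => ?_
  have hL : (QuotientAddGroup.mk (chartAt (ℂ × ℂ) p p) : (ℂ × ℂ) ⧸ L) = p := by
    rw [← chartAt_symm L p, (chartAt (ℂ × ℂ) p).left_inv (mem_chart_source _ p)]
  have hM : (QuotientAddGroup.mk (chartAt (ℂ × ℂ) (φ p) (φ p)) : (ℂ × ℂ) ⧸ M) = φ p := by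
    rw [← chartAt_symm M (φ p), (chartAt (ℂ × ℂ) (φ p)).left_inv (mem_chart_source _ _)]
  rw [chartAt_symm, chartAt_symm, h, map_add, QuotientAddGroup.mk_add, QuotientAddGroup.mk_add,
    ← h, hL, hM]

end ComplexTorus

namespace EisensteinCover

/-! ### The points over the origin -/

/-- 1 and ρ are independent over ℤ, a case of the lower bound for norms of nonzero elements of ℤ[ρ].
-/
theorem period_injective : Function.Injective period := by
  rw [injective_iff_map_eq_zero]
  intro a ha
  rw [period_apply, Prod.mk_eq_zero] at ha
  obtain ⟨h0, h1⟩ := eq_zero_of_norm_lt (a := a 0) (b := a 1) (by rw [ha.1]; simp)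
  obtain ⟨h2, h3⟩ := eq_zero_of_norm_lt (a := a 2) (b := a 3) (by rw [ha.2]; simp)
  funext i
  fin_cases i <;> assumption

theorem mk_mem_overOrigin {n j : ℕ} {δ : ZMod (3 ^ n)} {z : ℂ × ℂ} :
    (QuotientAddGroup.mk z : Cover n δ j) ∈ overOrigin n δ j ↔
      z.1 ∈ latticeE ∧ z.2 ∈ latticeE := by
  rw [← QuotientAddGroup.eq_zero_iff, ← QuotientAddGroup.eq_zero_iff, ← Prod.mk_inj]
  rfl

/-- As `period` is injective, a difference of periods lies in K_{n,j} only if its coordinates are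
killed by `sigma`. Thus `sigma` separates the points over the origin. -/
theorem mk_period_eq_iff {n j : ℕ} {δ : ZMod (3 ^ n)} {a b : Fin 4 → ℤ} :
    (QuotientAddGroup.mk (period a) : Cover n δ j) = QuotientAddGroup.mk (period b) ↔
      sigma n δ j a = sigma n δ j b := by
  rw [QuotientAddGroup.eq, ← map_neg, ← map_add, kernel,
    AddSubgroup.mem_map_iff_mem period_injective, AddMonoidHom.mem_ker, map_add, map_neg,
    neg_add_eq_zero]

theorem ncard_overOrigin (n j : ℕ) {δ : ZMod (3 ^ n)}
    (hδ : ∀ x, x ∈ AddSubgroup.zmultiples δ) : (overOrigin n δ j).ncard = 3 ^ n := by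
  have hs : Function.Surjective (sigma n δ j) := by
    intro x
    obtain ⟨m, hm⟩ := AddSubgroup.mem_zmultiples_iff.1 (hδ x)
    -- v₁ maps to the generator `δ`, so multiples of v₁ already reach every class.
    refine ⟨![m, 0, 0, 0], ?_⟩
    rw [sigma_apply, ← hm]
    simp
  obtain ⟨s, hs⟩ := hs.hasRightInverse
  -- A set-theoretic section of `sigma` suffices: two lifts of the same class give the same point of
  -- the torus.
  let f : ZMod (3 ^ n) → Cover n δ j := fun c => QuotientAddGroup.mk (period (s c))
  have hf : Function.Injective f := fun c d hcd => by
    rw [← hs c, ← hs d]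
    exact mk_period_eq_iff.1 hcd
  have hr : overOrigin n δ j = f '' Set.univ := by
    ext x
    obtain ⟨z, rfl⟩ := QuotientAddGroup.mk_surjective x
    rw [mk_mem_overOrigin, Set.image_univ]
    constructor
    · rintro ⟨h1, h2⟩
      obtain ⟨a, b, hab⟩ := exists_of_mem_latticeE h1
      obtain ⟨c, d, hcd⟩ := exists_of_mem_latticeE h2
      refine ⟨sigma n δ j ![a, b, c, d], ?_⟩
      have hz : z = period ![a, b, c, d] := by
        rw [period_apply]
        exact Prod.ext hab hcd
      rw [hz]
      exact mk_period_eq_iff.2 (hs _)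
    · rintro ⟨c, hc⟩
      rw [← mk_mem_overOrigin (δ := δ) (j := j), ← hc, mk_mem_overOrigin, period_apply]
      exact ⟨intCast_add_mul_rho_mem _ _, intCast_add_mul_rho_mem _ _⟩
  rw [hr, Set.ncard_image_of_injective _ hf, Set.ncard_univ, Nat.card_zmod]

/-! ### The shear -/

/-- The shear as a linear automorphism of `ℂ²`. -/
def shearEquiv (r : ℤ) : (ℂ × ℂ) ≃ₗ[ℂ] ℂ × ℂ where
  __ := shear r
  map_smul' c z := Prod.ext
    (by change c * z.1 + r * (c * z.2) = c * (z.1 + r * z.2); ring) rfl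
  invFun := shear (-r)
  left_inv z := Prod.ext
    (by change z.1 + r * z.2 + ((-r : ℤ) : ℂ) * z.2 = z.1; push_cast; ring) rfl
  right_inv z := Prod.ext
    (by change z.1 + ((-r : ℤ) : ℂ) * z.2 + r * z.2 = z.1; push_cast; ring) rfl

theorem shear_period (r : ℤ) (a : Fin 4 → ℤ) :
    shear r (period a) = period ![a 0 + r * a 2, a 1 + r * a 3, a 2, a 3] := by
  rw [period_apply, period_apply]
  refine Prod.ext ?_ rfl
  change (a 0 + a 1 * rho : ℂ) + r * (a 2 + a 3 * rho) =
    ((a 0 + r * a 2 : ℤ) : ℂ) + ((a 1 + r * a 3 : ℤ) : ℂ) * rho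
  push_cast
  ring

/-- The coefficient of the third and fourth coordinates becomes (r + k)δ; this is where r ≡ j - k
enters. -/
theorem sigma_shear {n j k : ℕ} (δ : ZMod (3 ^ n)) {r : ℤ}
    (hr : r ≡ (j : ℤ) - (k : ℤ) [ZMOD ((3 ^ n : ℕ) : ℤ)]) (a : Fin 4 → ℤ) :
    sigma n δ k ![a 0 + r * a 2, a 1 + r * a 3, a 2, a 3] = sigma n δ j a := by
  have hr' : (r : ZMod (3 ^ n)) = j - k := by
    simpa using (ZMod.intCast_eq_intCast_iff _ _ _).2 hr
  rw [sigma_apply, sigma_apply]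
  change ((a 0 + r * a 2 : ℤ) : ZMod (3 ^ n)) * δ + ((a 1 + r * a 3 : ℤ) : ZMod (3 ^ n)) * δ +
    a 2 * (k * δ) + a 3 * (k * δ) = _
  push_cast
  rw [hr']
  ring

theorem map_shear_kernel_le {n j k : ℕ} (δ : ZMod (3 ^ n)) {r : ℤ}
    (hr : r ≡ (j : ℤ) - (k : ℤ) [ZMOD ((3 ^ n : ℕ) : ℤ)]) :
    (kernel n δ j).map (shear r) ≤ kernel n δ k := by
  rintro _ ⟨_, ⟨a, ha, rfl⟩, rfl⟩
  refine ⟨_, ?_, (shear_period r a).symm⟩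
  rw [SetLike.mem_coe, AddMonoidHom.mem_ker] at ha ⊢
  rw [sigma_shear δ hr, ha]

theorem map_shear_kernel {n j k : ℕ} (δ : ZMod (3 ^ n)) {r : ℤ}
    (hr : r ≡ (j : ℤ) - (k : ℤ) [ZMOD ((3 ^ n : ℕ) : ℤ)]) :
    (kernel n δ j).map (shear r) = kernel n δ k := by
  refine le_antisymm (map_shear_kernel_le δ hr) fun z hz => ?_
  -- The inverse shear has parameter -r and exchanges the roles of `j` and `k`, so it supplies the
  -- preimage of `z`.
  have hr' : -r ≡ (k : ℤ) - (j : ℤ) [ZMOD ((3 ^ n : ℕ) : ℤ)] := by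
    simpa using hr.neg
  exact ⟨_, map_shear_kernel_le δ hr' ⟨z, hz, rfl⟩, (shearEquiv r).apply_symm_apply z⟩

/-- The isomorphism of covering tori induced by a shear. -/
noncomputable def coverEquiv {n j k : ℕ} (δ : ZMod (3 ^ n)) {r : ℤ}
    (hr : r ≡ (j : ℤ) - (k : ℤ) [ZMOD ((3 ^ n : ℕ) : ℤ)]) : Cover n δ j ≃+ Cover n δ k :=
  QuotientAddGroup.congr (kernel n δ j) (kernel n δ k) (shearEquiv r).toAddEquiv
    (map_shear_kernel δ hr)

/-! ### The induced isomorphisms of tori and of their blowups -/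

section

variable {n j k : ℕ} (δ : ZMod (3 ^ n)) {r : ℤ}
  (hr : r ≡ (j : ℤ) - (k : ℤ) [ZMOD ((3 ^ n : ℕ) : ℤ)])

theorem coverEquiv_mk (z : ℂ × ℂ) :
    coverEquiv δ hr (QuotientAddGroup.mk z) = QuotientAddGroup.mk (shear r z) := rfl

theorem isLocallyAffine_coverEquiv :
    IsLocallyAffine (coverEquiv δ hr).toEquiv (shearEquiv r) :=
  ComplexTorus.isLocallyAffine (coverEquiv_mk δ hr)

theorem isLocallyAffine_coverEquiv_symm :
    IsLocallyAffine (coverEquiv δ hr).toEquiv.symm (shearEquiv r).symm :=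
  ComplexTorus.isLocallyAffine fun _ => rfl

/-- Once z₂ lies in ℤ[ρ], so does r z₂, and adding it to z₁ does not affect membership. -/
theorem coverEquiv_mem_overOrigin (x : Cover n δ j) :
    (coverEquiv δ hr).toEquiv x ∈ overOrigin n δ k ↔ x ∈ overOrigin n δ j := by
  obtain ⟨z, rfl⟩ := QuotientAddGroup.mk_surjective x
  change (QuotientAddGroup.mk (shear r z) : Cover n δ k) ∈ _ ↔ _
  rw [mk_mem_overOrigin, mk_mem_overOrigin]
  refine and_congr_left fun h2 => ?_
  change z.1 + r * z.2 ∈ latticeE ↔ _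
  rw [← zsmul_eq_mul]
  exact latticeE.add_mem_cancel_right (latticeE.zsmul_mem h2 r)

/-- The biholomorphic map of covering tori induced by a shear. -/
noncomputable def coverDiffeomorph :
    Cover n δ j ≃ₘ^ω⟮𝓘(ℂ, ℂ × ℂ), 𝓘(ℂ, ℂ × ℂ)⟯ Cover n δ k where
  toEquiv := (coverEquiv δ hr).toEquiv
  contMDiff_toFun := (isLocallyAffine_coverEquiv δ hr).contMDiff
  contMDiff_invFun := (isLocallyAffine_coverEquiv_symm δ hr).contMDiff

/-- The biholomorphic map of blown up covering tori induced by a shear. -/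
noncomputable def coverBlowUpDiffeomorph :
    CoverBlowUp n δ j ≃ₘ^ω⟮𝓘(ℂ, ℂ × ℂ), 𝓘(ℂ, ℂ × ℂ)⟯ CoverBlowUp n δ k :=
  BlowUp.diffeomorph (coverEquiv δ hr).toEquiv (shearEquiv r) (isLocallyAffine_coverEquiv δ hr)
    (isLocallyAffine_coverEquiv_symm δ hr) (coverEquiv_mem_overOrigin δ hr)

theorem image_overOrigin :
    coverDiffeomorph δ hr '' overOrigin n δ j = overOrigin n δ k := by
  ext x
  constructor
  · rintro ⟨y, hy, rfl⟩
    exact (coverEquiv_mem_overOrigin δ hr y).2 hy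
  · intro hx
    refine ⟨(coverEquiv δ hr).toEquiv.symm x, ?_, (coverEquiv δ hr).toEquiv.apply_symm_apply x⟩
    rwa [← coverEquiv_mem_overOrigin δ hr, Equiv.apply_symm_apply]

end

end EisensteinCover

/-- The blown up covering tori `A*_{n, j}` and `A*_{n, k}` are biholomorphic. More precisely, the shear
with matrix `(1 r; 0 1)`, `r ≡ j - k` modulo `3ⁿ`, carries `K_{n, j}` onto `K_{n, k}`, and the induced
isomorphism of the covering tori preserves the points over the origin and lifts to the blowups. -/
theorem proposition3p3 (n j k : ℕ) (hj : j < 3 ^ n) (hk : k < 3 ^ n)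
    (δ : ZMod (3 ^ n)) (hδ : ∀ x, x ∈ AddSubgroup.zmultiples δ) :
    Nonempty (EisensteinCover.CoverBlowUp n δ j ≃ₘ^ω⟮𝓘(ℂ, ℂ × ℂ), 𝓘(ℂ, ℂ × ℂ)⟯
      EisensteinCover.CoverBlowUp n δ k) ∧
    (EisensteinCover.overOrigin n δ j).ncard = 3 ^ n ∧
    (EisensteinCover.overOrigin n δ k).ncard = 3 ^ n ∧
    ∀ r : ℤ, r ≡ (j : ℤ) - (k : ℤ) [ZMOD ((3 ^ n : ℕ) : ℤ)] →
      (EisensteinCover.kernel n δ j).map (EisensteinCover.shear r) =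
        EisensteinCover.kernel n δ k ∧
      ∃ φ : EisensteinCover.Cover n δ j ≃ₘ^ω⟮𝓘(ℂ, ℂ × ℂ), 𝓘(ℂ, ℂ × ℂ)⟯
          EisensteinCover.Cover n δ k,
        (∀ z : ℂ × ℂ, φ (QuotientAddGroup.mk z) =
          QuotientAddGroup.mk (EisensteinCover.shear r z)) ∧
        φ '' EisensteinCover.overOrigin n δ j = EisensteinCover.overOrigin n δ k ∧
        ∃ Φ : EisensteinCover.CoverBlowUp n δ j ≃ₘ^ω⟮𝓘(ℂ, ℂ × ℂ), 𝓘(ℂ, ℂ × ℂ)⟯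
            EisensteinCover.CoverBlowUp n δ k,
          ∀ y, (Φ y).pt = φ y.pt := by
  -- The first claim uses the shear with r equal to the integer j - k.
  exact ⟨⟨EisensteinCover.coverBlowUpDiffeomorph δ (Int.ModEq.refl _)⟩,
    EisensteinCover.ncard_overOrigin n j hδ, EisensteinCover.ncard_overOrigin n k hδ, fun r hr =>
    ⟨EisensteinCover.map_shear_kernel δ hr, EisensteinCover.coverDiffeomorph δ hr,
      EisensteinCover.coverEquiv_mk δ hr, EisensteinCover.image_overOrigin δ hr,
      EisensteinCover.coverBlowUpDiffeomorph δ hr, fun _ => rfl⟩⟩
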